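/- Let $\hbar\in\mathbb C$ be such that $\sinh\hbar\neq 0$ and $e^{\hbar}$ is a root of unity, and let $d$ be the order of $e^{\hbar}$. Put $s=d$ if $d$ is odd and $s=d/2$ if $d$ is even. Let $\widetilde U(\mathfrak{sl}_2)_\hbar$ be the universal Arens--Michael algebra (complete Hausdorff topological algebra, with unit, whose topology is defined by submultiplicative seminorms) generated by $E,F,H$ subject to $$[H,E]=2E,\qquad [H,F]=-2F,\qquad [E,F]=\frac{\sinh \hbar H}{\sinh \hbar}.$$ A continuous representation of $\widetilde U(\mathfrak{sl}_2)_\hbar$ on a complex Banach space $V$ is a continuous unital homomorphism from $\widetilde U(\mathfrak{sl}_2)_\hbar$ to the Banach algebra of bounded linear operators on $V$; it is irreducible if $V\neq 0$ and the only invariant linear subspaces (closed or not) are $0$ and $V$. Then every irreducible continuous representation of $\widetilde U(\mathfrak{sl}_2)_\hbar$ on a complex Banach space is finite dimensional, and its dimension is at most $s$. -/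

import Mathlib

open Filter Topology

noncomputable section

namespace QuantumSl2

/-! ### The defining relations -/

/-- The `n`-th term of the power series of `sinh (ħ h) / sinh ħ`. -/
def sinhTerm {A : Type*} [Ring A] [Algebra ℂ A] (ħ : ℂ) (h : A) (n : ℕ) : A :=
  (ħ ^ (2 * n + 1) / ((2 * n + 1).factorial : ℂ) / Complex.sinh ħ) • h ^ (2 * n + 1)

/-- The relations `[h, e] = 2 e`, `[h, f] = -2 f`, `[e, f] = sinh (ħ h) / sinh ħ` between elements
`e`, `f`, `h` of a topological algebra. -/
structure Relations {A : Type*} [Ring A] [Algebra ℂ A] [TopologicalSpace A]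
    (ħ : ℂ) (e f h : A) : Prop where
  he : h * e - e * h = (2 : ℂ) • e
  hf : h * f - f * h = (-2 : ℂ) • f
  ef : HasSum (sinhTerm ħ h) (e * f - f * e)

/-- Arens-Michael algebras: complete Hausdorff topological algebras whose topology is given by a
family of submultiplicative seminorms. -/
structure IsArensMichael (A : Type*) [Ring A] [Algebra ℂ A] [UniformSpace A] : Prop where
  isUniformAddGroup : IsUniformAddGroup A
  completeSpace : CompleteSpace A
  t0Space : T0Space A
  exists_seminorms : ∃ S : Set (Seminorm ℂ A),
    (∀ p ∈ S, ∀ a b : A, p (a * b) ≤ p a * p b) ∧ WithSeminorms (fun p : S ↦ (p : Seminorm ℂ A))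

theorem isTopologicalRing_of_submultiplicative {A ι : Type*} [Ring A] [Algebra ℂ A]
    [TopologicalSpace A] {p : SeminormFamily ℂ A ι} (hp : WithSeminorms p)
    (hmul : ∀ i, ∀ a b : A, p i (a * b) ≤ p i a * p i b) : IsTopologicalRing A := by
  have := hp.topologicalAddGroup
  have : ContinuousMul A := by
    rw [(p.withSeminorms_iff_topologicalSpace_eq_iInf).1 hp]
    refine continuousMul_iInf fun i ↦ ?_
    let R : SeminormedRing A :=
      { (inferInstance : Ring A), (p i).toSeminormedAddCommGroup with norm_mul_le := hmul i }
    exact @IsTopologicalSemiring.toContinuousMul A _ _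
      (@IsTopologicalRing.toIsTopologicalSemiring A _ _
        (@NonUnitalSeminormedRing.toIsTopologicalRing A R.toNonUnitalSeminormedRing))
  exact { continuous_neg := continuous_neg }

/-! ### The universal Arens-Michael algebra with these relations

It is the Hausdorff completion of the free algebra on `E`, `F`, `H` with respect to all
submultiplicative seminorms modulo which the relations hold. -/

/-- The names of the three generators. -/
inductive Gen : Type
  | E
  | F
  | H

/-- The free complex algebra on `E`, `F`, `H`, to be endowed with a topology depending on `ħ`. -/
def Free (_ħ : ℂ) : Type := FreeAlgebra ℂ Gen

variable (ħ : ℂ)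

instance : Ring (Free ħ) := inferInstanceAs (Ring (FreeAlgebra ℂ Gen))

instance : Algebra ℂ (Free ħ) := inferInstanceAs (Algebra ℂ (FreeAlgebra ℂ Gen))

/-- The generators of the free algebra. -/
def Free.gen (x : Gen) : Free ħ := FreeAlgebra.ι ℂ x

/-- The submultiplicative seminorms on the free algebra for which the defining relations hold in the
associated Hausdorff completion, that is, hold up to elements of seminorm zero. -/
structure IsAdmissible (p : Seminorm ℂ (Free ħ)) : Prop where
  mul_le : ∀ a b : Free ħ, p (a * b) ≤ p a * p b
  he : p (Free.gen ħ .H * Free.gen ħ .E - Free.gen ħ .E * Free.gen ħ .H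
    - (2 : ℂ) • Free.gen ħ .E) = 0
  hf : p (Free.gen ħ .H * Free.gen ħ .F - Free.gen ħ .F * Free.gen ħ .H
    - (-2 : ℂ) • Free.gen ħ .F) = 0
  ef : Tendsto (fun s : Finset ℕ ↦ p (∑ n ∈ s, sinhTerm ħ (Free.gen ħ .H) n
    - (Free.gen ħ .E * Free.gen ħ .F - Free.gen ħ .F * Free.gen ħ .E))) atTop (𝓝 0)

/-- The family of all admissible seminorms. -/
def admissible : SeminormFamily ℂ (Free ħ) {p : Seminorm ℂ (Free ħ) // IsAdmissible ħ p} :=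
  fun p ↦ p.1

/-- The uniform structure defined by all admissible seminorms. -/
instance : UniformSpace (Free ħ) :=
  ⨅ p, (admissible ħ p).toSeminormedAddCommGroup.toUniformSpace

instance : IsUniformAddGroup (Free ħ) :=
  isUniformAddGroup_iInf fun p ↦
    letI := (admissible ħ p).toSeminormedAddCommGroup
    inferInstance

theorem withSeminorms_free : WithSeminorms (admissible ħ) :=
  ((admissible ħ).withSeminorms_iff_uniformSpace_eq_iInf).2 rfl

instance : ContinuousSMul ℂ (Free ħ) := (withSeminorms_free ħ).continuousSMul

instance : IsTopologicalRing (Free ħ) :=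
  isTopologicalRing_of_submultiplicative (withSeminorms_free ħ) fun p ↦ p.2.mul_le

instance : UniformContinuousConstSMul ℂ (Free ħ) :=
  uniformContinuousConstSMul_of_continuousConstSMul ℂ (Free ħ)

end QuantumSl2

open QuantumSl2 in
/-- The universal Arens-Michael algebra `Ũ(sl₂)_ħ` generated by `E`, `F`, `H` subject to
`[H, E] = 2 E`, `[H, F] = -2 F`, `[E, F] = sinh (ħ H) / sinh ħ`. -/
abbrev QuantumSl2 (ħ : ℂ) : Type := UniformSpace.Completion (QuantumSl2.Free ħ)

namespace QuantumSl2

variable (ħ : ℂ)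

/-- The generators of `Ũ(sl₂)_ħ`. -/
def gen (x : Gen) : QuantumSl2 ħ := (Free.gen ħ x : Free ħ)

/-- The continuous extension of an admissible seminorm to the completion. -/
def extendSeminorm (p : {p : Seminorm ℂ (Free ħ) // IsAdmissible ħ p}) :
    Seminorm ℂ (QuantumSl2 ħ) :=
  have hu : UniformContinuous (admissible ħ p) :=
    Seminorm.uniformContinuous_of_continuousAt_zero
      ((withSeminorms_free ħ).continuous_seminorm p).continuousAt
  have hc : Continuous (UniformSpace.Completion.extension (admissible ħ p)) :=
    UniformSpace.Completion.continuous_extension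
  Seminorm.of (UniformSpace.Completion.extension (admissible ħ p))
    (fun x y ↦ UniformSpace.Completion.induction_on₂ x y
      (isClosed_le (by fun_prop) (by fun_prop)) fun a b ↦ by
        rw [← UniformSpace.Completion.coe_add]
        simpa only [UniformSpace.Completion.extension_coe hu] using map_add_le_add _ a b)
    (fun c x ↦ UniformSpace.Completion.induction_on x
      (isClosed_eq (hc.comp (continuous_const_smul c)) (by fun_prop)) fun a ↦ by
        rw [← UniformSpace.Completion.coe_smul]
        simpa only [UniformSpace.Completion.extension_coe hu] using map_smul_eq_mul _ c a)

theorem extendSeminorm_coe (p : {p : Seminorm ℂ (Free ħ) // IsAdmissible ħ p}) (x : Free ħ) :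
    extendSeminorm ħ p (x : QuantumSl2 ħ) = admissible ħ p x :=
  UniformSpace.Completion.extension_coe
    (Seminorm.uniformContinuous_of_continuousAt_zero
      ((withSeminorms_free ħ).continuous_seminorm p).continuousAt) x

theorem continuous_extendSeminorm (p : {p : Seminorm ℂ (Free ħ) // IsAdmissible ħ p}) :
    Continuous (extendSeminorm ħ p) :=
  UniformSpace.Completion.continuous_extension (f := admissible ħ p)

/-- `Ũ(sl₂)_ħ` is an Arens-Michael algebra. -/
theorem isArensMichael : IsArensMichael (QuantumSl2 ħ) := by
  refine ⟨inferInstance, inferInstance, inferInstance, Set.range (extendSeminorm ħ), ?_, ?_⟩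
  · rintro _ ⟨p, rfl⟩ a b
    have hc := continuous_extendSeminorm ħ p
    refine UniformSpace.Completion.induction_on₂ a b
      (isClosed_le (by fun_prop) (by fun_prop)) fun x y ↦ ?_
    rw [← UniformSpace.Completion.coe_mul]
    rw [extendSeminorm_coe, extendSeminorm_coe, extendSeminorm_coe]
    exact p.2.mul_le x y
  · rw [SeminormFamily.withSeminorms_iff_nhds_eq_iInf]
    refine le_antisymm (le_iInf ?_) fun U hU ↦ ?_
    · rintro ⟨_, p, rfl⟩
      have hc := (continuous_extendSeminorm ħ p).tendsto 0
      rw [map_zero] at hc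
      exact hc.le_comap
    · obtain ⟨C, hC, hCc, hCU⟩ := exists_mem_nhds_isClosed_subset hU
      have h0 : ((↑) : Free ħ → QuantumSl2 ħ) ⁻¹' C ∈ 𝓝 0 :=
        (UniformSpace.Completion.continuous_coe (Free ħ)).continuousAt.preimage_mem_nhds
          (by rwa [UniformSpace.Completion.coe_zero])
      obtain ⟨s, r, hr, hsr⟩ := ((withSeminorms_free ħ).mem_nhds_iff _ _).1 h0
      let O : Set (QuantumSl2 ħ) := {x | ∀ p ∈ s, extendSeminorm ħ p x < r}
      have hO : IsOpen O := by
        have : O = ⋂ p ∈ s, {x | extendSeminorm ħ p x < r} := by ext; simp [O]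
        rw [this]
        exact isOpen_biInter_finset fun p _ ↦
          isOpen_lt (continuous_extendSeminorm ħ p) continuous_const
      have hOU : O ⊆ U := by
        refine fun x hx ↦ hCU ?_
        have h1 := UniformSpace.Completion.denseRange_coe.open_subset_closure_inter hO hx
        refine closure_minimal ?_ hCc h1
        rintro _ ⟨hy, y, rfl⟩
        refine hsr ?_
        rw [Seminorm.mem_ball_zero]
        refine Seminorm.finset_sup_apply_lt hr fun p hp ↦ ?_
        rw [← extendSeminorm_coe]
        exact hy p hp
      refine mem_of_superset ?_ hOU
      have : O = ⋂ p ∈ s, {x | extendSeminorm ħ p x < r} := by ext; simp [O]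
      rw [this, biInter_finset_mem]
      intro p _
      refine mem_iInf_of_mem (⟨extendSeminorm ħ p, p, rfl⟩ : Set.range (extendSeminorm ħ)) ?_
      exact preimage_mem_comap (m := extendSeminorm ħ p) (Iio_mem_nhds hr)

/-- The generators of `Ũ(sl₂)_ħ` satisfy the defining relations. -/
theorem relations : Relations ħ (gen ħ .E) (gen ħ .F) (gen ħ .H) := by
  have hc := UniformSpace.Completion.continuous_coeRingHom (α := Free ħ)
  have h0 : ∀ x y : Free ħ, (∀ p, admissible ħ p (x - y) = 0) → (x : QuantumSl2 ħ) = y := by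
    intro x y hxy
    have h : Tendsto (fun _ : ℕ ↦ x) atTop (𝓝 y) :=
      ((withSeminorms_free ħ).tendsto_nhds _ y).2 fun i ε hε ↦
        Eventually.of_forall fun _ ↦ by rwa [hxy i]
    exact tendsto_nhds_unique tendsto_const_nhds ((hc.tendsto y).comp h)
  have hs : ∀ (c : ℂ) (x : Free ħ), ((c • x : Free ħ) : QuantumSl2 ħ) = c • (x : QuantumSl2 ħ) :=
    fun c x ↦ UniformSpace.Completion.coe_smul c x
  have hm : ∀ x y : Free ħ, ((x * y : Free ħ) : QuantumSl2 ħ) = x * y :=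
    fun x y ↦ UniformSpace.Completion.coe_mul x y
  have hb : ∀ x y : Free ħ, ((x - y : Free ħ) : QuantumSl2 ħ) = x - y :=
    fun x y ↦ UniformSpace.Completion.coe_sub x y
  refine ⟨?_, ?_, ?_⟩
  · simpa only [gen, hs, hm, hb] using h0 _ _ fun p ↦ p.2.he
  · simpa only [gen, hs, hm, hb] using h0 _ _ fun p ↦ p.2.hf
  · have h : HasSum (sinhTerm ħ (Free.gen ħ .H))
        (Free.gen ħ .E * Free.gen ħ .F - Free.gen ħ .F * Free.gen ħ .E) :=
      ((withSeminorms_free ħ).tendsto_nhds _ _).2 fun p ε hε ↦ p.2.ef.eventually_lt_const hε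
    have h' := h.map (UniformSpace.Completion.coeRingHom (α := Free ħ)) hc
    have ht : sinhTerm ħ (gen ħ .H) =
        UniformSpace.Completion.coeRingHom (α := Free ħ) ∘ sinhTerm ħ (Free.gen ħ .H) := by
      funext n
      exact ((hs _ _).trans (congrArg _
        (map_pow (UniformSpace.Completion.coeRingHom (α := Free ħ)) _ _))).symm
    rw [ht]
    exact ((hb _ _).trans (congrArg₂ _ (hm _ _) (hm _ _))) ▸ h'

/-- The universal property: every triple in an Arens-Michael algebra that satisfies the relations is
the image of `E`, `F`, `H` under a unique continuous unital homomorphism. -/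
theorem existsUnique_lift {B : Type*} [Ring B] [Algebra ℂ B] [UniformSpace B]
    (hB : IsArensMichael B) {e f h : B} (hr : Relations ħ e f h) :
    ∃! φ : QuantumSl2 ħ →A[ℂ] B, φ (gen ħ .E) = e ∧ φ (gen ħ .F) = f ∧ φ (gen ħ .H) = h := by
  obtain ⟨_, _, _, S, hS, hW⟩ := hB
  have : IsTopologicalRing B := isTopologicalRing_of_submultiplicative hW fun p ↦ hS p p.2
  let g : Gen → B := fun x ↦ Gen.casesOn x e f h
  let ψ : Free ħ →ₐ[ℂ] B := FreeAlgebra.lift ℂ g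
  have hψ : ∀ x, ψ (Free.gen ħ x) = g x := fun x ↦ FreeAlgebra.lift_ι_apply g x
  have hadm : ∀ p : S, IsAdmissible ħ ((p : Seminorm ℂ B).comp ψ.toLinearMap) := by
    intro p
    refine ⟨fun a b ↦ ?_, ?_, ?_, ?_⟩
    · simpa using hS p p.2 (ψ a) (ψ b)
    · simp [hψ, g, hr.he]
    · have := hr.hf
      simp [hψ, g] at this ⊢
      simp [this]
    · have h1 := (hW.tendsto_nhds _ _).1 hr.ef p
      have ht : ∀ s : Finset ℕ, ψ (∑ n ∈ s, sinhTerm ħ (Free.gen ħ .H) n) =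
          ∑ n ∈ s, sinhTerm ħ h n := by
        intro s
        simp [sinhTerm, hψ, g]
      rw [Metric.tendsto_nhds]
      intro ε hε
      filter_upwards [h1 ε hε] with s hs
      simpa [ht, hψ, g, -map_sum, abs_of_nonneg] using hs
  have hcont : Continuous ψ := by
    refine WithSeminorms.continuous_of_isBounded (withSeminorms_free ħ) hW ψ.toLinearMap
      fun p ↦ ?_
    exact ⟨{⟨_, hadm p⟩}, 1, by simp [admissible]⟩
  have hext : ∀ x : Free ħ, UniformSpace.Completion.extensionHom ψ.toRingHom hcont x = ψ x :=
    fun x ↦ UniformSpace.Completion.extensionHom_coe _ _ x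
  let φ : QuantumSl2 ħ →A[ℂ] B :=
    { UniformSpace.Completion.extensionHom ψ.toRingHom hcont with
      commutes' := fun c ↦ (hext (algebraMap ℂ (Free ħ) c)).trans (ψ.commutes c)
      cont := UniformSpace.Completion.continuous_extension }
  refine ⟨φ, ⟨(hext _).trans (hψ .E), (hext _).trans (hψ .F), (hext _).trans (hψ .H)⟩, ?_⟩
  rintro χ ⟨h1, h2, h3⟩
  let coeHom : Free ħ →ₐ[ℂ] QuantumSl2 ħ :=
    { UniformSpace.Completion.coeRingHom (α := Free ħ) with commutes' := fun _ ↦ rfl }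
  have hχ : (χ : QuantumSl2 ħ →ₐ[ℂ] B).comp coeHom = ψ := by
    refine FreeAlgebra.hom_ext (funext fun x ↦ ?_)
    refine Eq.trans ?_ (hψ x).symm
    cases x
    exacts [h1, h2, h3]
  ext x
  refine UniformSpace.Completion.induction_on x (isClosed_eq χ.cont φ.cont) fun a ↦ ?_
  exact (DFunLike.congr_fun hχ a).trans (hext a).symm

/-! ### Representations -/

/-- A continuous representation on a Banach space `V`, that is, a continuous unital homomorphism into
the Banach algebra of bounded operators on `V`, is irreducible if `V` is nonzero and no linear
subspace except `0` and `V` is invariant. -/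
structure IsIrreducible {A : Type*} [Ring A] [Algebra ℂ A] [TopologicalSpace A]
    {V : Type*} [NormedAddCommGroup V] [NormedSpace ℂ V] (T : A →A[ℂ] (V →L[ℂ] V)) : Prop where
  nontrivial : Nontrivial V
  eq_bot_or_eq_top : ∀ W : Submodule ℂ V, (∀ a : A, ∀ w ∈ W, T a w ∈ W) → W = ⊥ ∨ W = ⊤

end QuantumSl2

end

namespace QuantumSl2

/-! ### Operators in the image of a representation -/

/-! In a Banach algebra `[H, E] = 2E` and `[H, F] = -2F` force `E` and `F` to be nilpotent
(`isNilpotent_of_commutator`). Since `e^{2sħ} = 1`, the operator `exp(sħH)` commutes with all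
generators, so by Schur's lemma it is a scalar; this forces `H` to have an eigenvector
(`exists_eigenvector_of_exp_eq_algebraMap`), and nilpotency of `E` then gives a highest weight
vector `v`.

As `sinh(sħ) = 0`, `Relations.apply_pow_succ` gives `E F^s v = 0`, so the vectors `F^{s+n} v` span
an invariant subspace. It cannot be all of `V`, since the nilpotent `F` would be surjective; hence
`F^s v = 0`, and `V` is spanned by `v, F v, …, F^{s-1} v`. -/

theorem map_mem_of_isClosed {ħ : ℂ} {B : Type*} [Ring B] [Algebra ℂ B] [TopologicalSpace B]
    (T : QuantumSl2 ħ →A[ℂ] B) (S : Subalgebra ℂ B) (hS : IsClosed (S : Set B))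
    (hgen : ∀ x, T (gen ħ x) ∈ S) (a : QuantumSl2 ħ) : T a ∈ S := by
  let coeHom : Free ħ →ₐ[ℂ] QuantumSl2 ħ :=
    { UniformSpace.Completion.coeRingHom (α := Free ħ) with commutes' := fun _ ↦ rfl }
  let ψ : FreeAlgebra ℂ Gen →ₐ[ℂ] B := (T : QuantumSl2 ħ →ₐ[ℂ] B).comp coeHom
  have hψ : ψ.range ≤ S := by
    rw [← Algebra.map_top, ← FreeAlgebra.adjoin_range_ι, AlgHom.map_adjoin, Algebra.adjoin_le_iff]
    rintro _ ⟨_, ⟨x, rfl⟩, rfl⟩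
    exact hgen x
  exact UniformSpace.Completion.induction_on a (hS.preimage T.cont) fun x ↦ hψ ⟨x, rfl⟩

theorem Relations.map {ħ : ℂ} {A B : Type*} [Ring A] [Algebra ℂ A] [TopologicalSpace A]
    [Ring B] [Algebra ℂ B] [TopologicalSpace B] {e f h : A} (hr : Relations ħ e f h)
    (T : A →A[ℂ] B) : Relations ħ (T e) (T f) (T h) where
  he := by simpa using congrArg T hr.he
  hf := by simpa using congrArg T hr.hf
  ef := by
    have := hr.ef.map T T.cont
    convert this using 1
    · funext n
      simp [sinhTerm]
    · simp

/-! ### Commutators and exponentials in Banach algebras -/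

section Algebra

variable {A : Type*} [NormedRing A] [NormedAlgebra ℂ A]

theorem mul_pow_of_commutator {x y : A} {c : ℂ} (h : x * y - y * x = c • y) (n : ℕ) :
    x * y ^ n = y ^ n * x + (n * c) • y ^ n := by
  induction n with
  | zero => simp
  | succ n ih =>
    rw [pow_succ, ← mul_assoc, ih, add_mul, mul_assoc, sub_eq_iff_eq_add'.1 h, mul_add,
      mul_smul_comm, smul_mul_assoc, mul_assoc, add_assoc, ← add_smul]
    congr 2
    push_cast
    ring

/-- A nonzero `y ^ n` would be an eigenvector of `ad x` with eigenvalue `n * c`, but `ad x` has norm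
at most `2 * ‖x‖`. -/
theorem isNilpotent_of_commutator {x y : A} {c : ℂ} (hc : c ≠ 0) (h : x * y - y * x = c • y) :
    IsNilpotent y := by
  obtain ⟨n, hn⟩ := exists_nat_gt (2 * ‖x‖ / ‖c‖)
  refine ⟨n, by_contra fun h0 ↦ ?_⟩
  have hpos : 0 < ‖y ^ n‖ := norm_pos_iff.2 h0
  have h1 : (n * c) • y ^ n = x * y ^ n - y ^ n * x := by
    rw [mul_pow_of_commutator h n]
    abel
  have h2 : n * ‖c‖ * ‖y ^ n‖ ≤ 2 * ‖x‖ * ‖y ^ n‖ := by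
    calc n * ‖c‖ * ‖y ^ n‖ = ‖x * y ^ n - y ^ n * x‖ := by rw [← h1, norm_smul]; simp
      _ ≤ ‖x * y ^ n‖ + ‖y ^ n * x‖ := norm_sub_le _ _
      _ ≤ ‖x‖ * ‖y ^ n‖ + ‖y ^ n‖ * ‖x‖ := add_le_add (norm_mul_le _ _) (norm_mul_le _ _)
      _ = _ := by ring
  rw [div_lt_iff₀ (norm_pos_iff.2 hc)] at hn
  exact absurd (le_of_mul_le_mul_right h2 hpos) (not_le.2 hn)

variable [CompleteSpace A]

theorem exists_exp_eq_add_sq_mul (x : A) :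
    ∃ y : A, Commute x y ∧ NormedSpace.exp x = 1 + x + x ^ 2 * y := by
  have hs : Summable fun n : ℕ ↦ ((n + 2).factorial⁻¹ : ℂ) • x ^ n := by
    refine Summable.of_norm_bounded (NormedSpace.norm_expSeries_summable' (𝕂 := ℂ) x) fun n ↦ ?_
    rw [norm_smul, norm_smul]
    refine mul_le_mul_of_nonneg_right ?_ (norm_nonneg _)
    simp only [norm_inv, Complex.norm_natCast]
    gcongr
    omega
  refine ⟨∑' n : ℕ, ((n + 2).factorial⁻¹ : ℂ) • x ^ n,
    Commute.tsum_right _ fun n ↦ ((Commute.refl x).pow_right n).smul_right (_ : ℂ), ?_⟩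
  have h := (hasSum_nat_add_iff' 2).2 (NormedSpace.exp_series_hasSum_exp' (𝕂 := ℂ) x)
  have h' := hs.hasSum.mul_left (x ^ 2)
  have := h.unique (h'.congr_fun fun n ↦ ?_)
  · rw [← this]
    simp [Finset.sum_range_succ]
  · rw [mul_smul_comm, ← pow_add, add_comm n 2]

/-- Writing `exp x = 1 + x + x²y` gives `x(1 + xy) = t - 1`. As `x` is not invertible, `t = 1`, and
for the same reason `1 + xy ≠ 0`. -/
theorem exists_mul_eq_zero_of_exp_eq_algebraMap {x : A} {t : ℂ} (hx : ¬IsUnit x)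
    (h : NormedSpace.exp x = algebraMap ℂ A t) : ∃ y : A, y ≠ 0 ∧ x * y = 0 := by
  obtain ⟨y, hxy, hexp⟩ := exists_exp_eq_add_sq_mul x
  have hc : Commute x (1 + x * y) := (Commute.one_right x).add_right ((Commute.refl x).mul_right hxy)
  have h1 : x * (1 + x * y) = algebraMap ℂ A (t - 1) := by
    rw [map_sub, ← h, hexp, map_one]
    noncomm_ring
  have ht : t - 1 = 0 := by
    by_contra ht
    have hu : IsUnit (x * (1 + x * y)) := h1 ▸ (IsUnit.mk0 _ ht).map (algebraMap ℂ A)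
    exact hx (hc.isUnit_mul_iff.1 hu).1
  refine ⟨1 + x * y, fun h0 ↦ hx ?_, by rw [h1, ht, map_zero]⟩
  have hu : IsUnit (x * y) := by
    rw [eq_neg_of_add_eq_zero_right h0]
    exact isUnit_one.neg
  exact (hxy.isUnit_mul_iff.1 hu).1

/-- Moving `y` to the left replaces `x` by `x + c`, which multiplies `exp(rx)` by `e^{rc} = 1`. -/
theorem commute_exp_of_commutator {x y : A} {c r : ℂ} (h : x * y - y * x = c • y)
    (hr : Complex.exp (r * c) = 1) : Commute (NormedSpace.exp (r • x)) y := by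
  let _ : NormedAlgebra ℚ A := NormedAlgebra.restrictScalars ℚ ℂ A
  have hxy : x * y = y * (x + algebraMap ℂ A c) := by
    rw [mul_add, ← Algebra.commutes, ← Algebra.smul_def, ← h]
    abel
  have hpow (n : ℕ) : (r • x) ^ n * y = y * (r • (x + algebraMap ℂ A c)) ^ n := by
    induction n with
    | zero => simp
    | succ n ih =>
      rw [pow_succ, pow_succ, mul_assoc, smul_mul_assoc, hxy, ← mul_smul_comm, ← mul_assoc, ih,
        mul_assoc]
  have h1 := (NormedSpace.exp_series_hasSum_exp' (𝕂 := ℂ) (r • x)).mul_right y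
  have h2 := (NormedSpace.exp_series_hasSum_exp' (𝕂 := ℂ)
    (r • (x + algebraMap ℂ A c))).mul_left y
  have h3 : NormedSpace.exp (r • x) * y = y * NormedSpace.exp (r • (x + algebraMap ℂ A c)) :=
    h1.unique (h2.congr_fun fun n ↦ by rw [smul_mul_assoc, hpow, mul_smul_comm])
  have h4 : NormedSpace.exp (r • (x + algebraMap ℂ A c)) = NormedSpace.exp (r • x) := by
    have hrc : r • algebraMap ℂ A c = algebraMap ℂ A (r * c) := by
      rw [map_mul, ← Algebra.smul_def]
    rw [smul_add, hrc, NormedSpace.exp_add_of_commute (Algebra.commutes _ _).symm,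
      ← NormedSpace.algebraMap_exp_comm, ← Complex.exp_eq_exp_ℂ, hr, map_one, mul_one]
  exact h3.trans (by rw [h4])

end Algebra

/-! ### Weight vectors of operators satisfying the relations -/

section Banach

variable {V : Type*} [NormedAddCommGroup V] [NormedSpace ℂ V]

theorem pow_succ_apply (x : V →L[ℂ] V) (n : ℕ) (v : V) : (x ^ (n + 1)) v = x ((x ^ n) v) := by
  rw [pow_succ']
  rfl

theorem Relations.apply_of_eigenvector {ħ : ℂ} {e f h : V →L[ℂ] V} (hr : Relations ħ e f h)
    {ν : ℂ} {v : V} (hv : h v = ν • v) :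
    e (f v) - f (e v) = (Complex.sinh (ħ * ν) / Complex.sinh ħ) • v := by
  have hpow (n : ℕ) : (h ^ n) v = ν ^ n • v := by
    induction n with
    | zero => simp
    | succ n ih => rw [pow_succ_apply, ih, map_smul, hv, smul_smul, pow_succ]
  have h1 := hr.ef.mapL (ContinuousLinearMap.apply ℂ V v)
  have h2 := ((Complex.hasSum_sinh (ħ * ν)).div_const (Complex.sinh ħ)).smul_const v
  refine HasSum.unique (f := fun n ↦ ContinuousLinearMap.apply ℂ V v (sinhTerm ħ h n)) h1
    (h2.congr_fun fun n ↦ ?_)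
  simp only [sinhTerm, ContinuousLinearMap.apply_apply, smul_apply, hpow,
    smul_smul]
  congr 1
  ring

theorem apply_pow_of_commutator {x y : V →L[ℂ] V} {c ν : ℂ} (h : x * y - y * x = c • y) {v : V}
    (hv : x v = ν • v) (n : ℕ) : x ((y ^ n) v) = (ν + n * c) • (y ^ n) v := by
  have := congrArg (fun z : V →L[ℂ] V ↦ z v) (mul_pow_of_commutator h n)
  simpa [hv, add_smul] using this

theorem Relations.apply_pow_succ {ħ : ℂ} {e f h : V →L[ℂ] V} (hr : Relations ħ e f h)
    (hħ : Complex.sinh ħ ≠ 0) {ν : ℂ} {v : V} (hv : h v = ν • v) (hev : e v = 0) (n : ℕ) :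
    e ((f ^ (n + 1)) v) = (Complex.sinh ((n + 1 : ℕ) * ħ) * Complex.sinh (ħ * (ν - n)) /
      Complex.sinh ħ ^ 2) • (f ^ n) v := by
  induction n with
  | zero =>
    have := hr.apply_of_eigenvector hv
    rw [hev, map_zero, sub_zero] at this
    simp only [zero_add, pow_one, this, Nat.cast_one, one_mul, Nat.cast_zero, sub_zero, pow_zero,
      one_apply_eq_self]
    congr 1
    field_simp
  | succ n ih =>
    have h1 := hr.apply_of_eigenvector (apply_pow_of_commutator hr.hf hv (n + 1))
    rw [ih, map_smul, sub_eq_iff_eq_add] at h1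
    rw [pow_succ_apply f (n + 1), h1, ← pow_succ_apply, ← add_smul]
    congr 1
    -- With `a = (n+1)ħ` and `b = ħ(ν-n-1)`, the claim is `sinh(a+ħ) sinh b = sinh ħ sinh(b-a) +
    -- sinh a sinh(b+ħ)`.
    have e1 : ((n + 1 + 1 : ℕ) : ℂ) * ħ = (n + 1 : ℕ) * ħ + ħ := by push_cast; ring
    have e2 : ħ * (ν - n) = ħ * (ν - (n + 1 : ℕ)) + ħ := by push_cast; ring
    have e3 : ħ * (ν + (n + 1 : ℕ) * -2) = ħ * (ν - (n + 1 : ℕ)) - (n + 1 : ℕ) * ħ := by ring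
    rw [e1, e2, e3, Complex.sinh_add, Complex.sinh_add, Complex.sinh_sub]
    field_simp
    ring

/-- Any spectral value `μ` of `h` is an eigenvalue: `r(h - μ)` is not invertible and has scalar
exponential, so it annihilates the image of a nonzero operator. -/
theorem exists_eigenvector_of_exp_eq_algebraMap [CompleteSpace V] [Nontrivial V] {h : V →L[ℂ] V}
    {r t : ℂ} (hr : r ≠ 0) (hexp : NormedSpace.exp (r • h) = algebraMap ℂ _ t) :
    ∃ (μ : ℂ) (v : V), v ≠ 0 ∧ h v = μ • v := by
  obtain ⟨μ, hμ⟩ := spectrum.nonempty h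
  have hx : ¬IsUnit (r • (h - algebraMap ℂ _ μ)) := by
    rw [spectrum.mem_iff, ← IsUnit.neg_iff, neg_sub] at hμ
    exact fun hu ↦ hμ ((isUnit_smul_iff (Units.mk0 r hr) _).1 hu)
  have hexp' : NormedSpace.exp (r • (h - algebraMap ℂ _ μ)) =
      algebraMap ℂ (V →L[ℂ] V) (t * NormedSpace.exp (r * -μ)) := by
    let _ : NormedAlgebra ℚ (V →L[ℂ] V) := NormedAlgebra.restrictScalars ℚ ℂ _
    have hc : Commute (r • h) (algebraMap ℂ (V →L[ℂ] V) (r * -μ)) :=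
      (Algebra.commutes _ _).symm
    rw [map_mul, ← hexp, NormedSpace.algebraMap_exp_comm, ← NormedSpace.exp_add_of_commute hc]
    congr 1
    rw [smul_sub, map_mul, map_neg, ← Algebra.smul_def, smul_neg, sub_eq_add_neg]
  obtain ⟨y, hy, hxy⟩ := exists_mul_eq_zero_of_exp_eq_algebraMap hx hexp'
  obtain ⟨w, hw⟩ : ∃ w, y w ≠ 0 := by
    by_contra! h0
    exact hy (ContinuousLinearMap.ext h0)
  refine ⟨μ, y w, hw, ?_⟩
  have := congrArg (fun z : V →L[ℂ] V ↦ z w) hxy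
  simpa [hr, sub_eq_zero, Algebra.algebraMap_eq_smul_one] using this

/-- Take the last nonzero vector among the `e ^ n w`; each of them is a weight vector. -/
theorem exists_highest_weight_vector {e h : V →L[ℂ] V} (he : h * e - e * h = (2 : ℂ) • e)
    {μ : ℂ} {w : V} (hw : w ≠ 0) (hμ : h w = μ • w) :
    ∃ (ν : ℂ) (v : V), v ≠ 0 ∧ h v = ν • v ∧ e v = 0 := by
  classical
  obtain ⟨N, hN⟩ := isNilpotent_of_commutator two_ne_zero he
  have hex : ∃ n, (e ^ n) w = 0 := ⟨N, by simp [hN]⟩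
  obtain ⟨n, hn⟩ := Nat.exists_eq_succ_of_ne_zero (n := Nat.find hex) fun h0 ↦ hw <| by
    have := Nat.find_spec hex
    rwa [h0] at this
  refine ⟨_, (e ^ n) w, Nat.find_min hex (by omega), apply_pow_of_commutator he hμ n, ?_⟩
  have := Nat.find_spec hex
  rwa [hn, pow_succ_apply] at this

/-! ### Schur's lemma and the dimension bound -/

namespace IsIrreducible

variable {ħ : ℂ} {T : QuantumSl2 ħ →A[ℂ] (V →L[ℂ] V)}

/-- Schur's lemma: for `t` in the spectrum of `c`, the kernel and range of `t - c` are invariant.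
The range need not be closed, so irreducibility is used for arbitrary subspaces; a bijective `t - c`
would be invertible by the open mapping theorem. -/
theorem eq_algebraMap_of_commute [CompleteSpace V] (hT : IsIrreducible T) {c : V →L[ℂ] V}
    (hc : ∀ x, Commute c (T (gen ħ x))) : ∃ t : ℂ, c = algebraMap ℂ _ t := by
  have := hT.nontrivial
  have hcomm (a : QuantumSl2 ħ) : Commute c (T a) :=
    (Subalgebra.mem_centralizer_iff ℂ).1 (map_mem_of_isClosed T (Subalgebra.centralizer ℂ {c})
      (Set.isClosed_centralizer {c}) (fun x ↦ (Subalgebra.mem_centralizer_iff ℂ).2 <| by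
        rintro _ rfl; exact hc x) a) c rfl
  obtain ⟨t, ht⟩ := spectrum.nonempty c
  refine ⟨t, ?_⟩
  rw [spectrum.mem_iff] at ht
  set d := algebraMap ℂ (V →L[ℂ] V) t - c with hd
  have hdc (a : QuantumSl2 ħ) (w : V) : d (T a w) = T a (d w) :=
    congrArg (fun z : V →L[ℂ] V ↦ z w)
      (Commute.sub_left (Algebra.commutes t (T a)) (hcomm a)).eq
  have hker := hT.eq_bot_or_eq_top d.ker fun a w hw ↦ by
    rw [LinearMap.mem_ker] at hw ⊢
    exact (hdc a w).trans (by rw [show d w = 0 from hw, map_zero])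
  have hrange := hT.eq_bot_or_eq_top d.range (by
    rintro a _ ⟨w, rfl⟩
    exact ⟨T a w, hdc a w⟩)
  have hzero : d = 0 := by
    rcases hker with hker | hker
    · rcases hrange with hrange | hrange
      · exact ContinuousLinearMap.coe_injective (LinearMap.range_eq_bot.1 hrange)
      · exact absurd (ContinuousLinearMap.isUnit_iff_bijective.2
          ⟨LinearMap.ker_eq_bot.1 hker, LinearMap.range_eq_top.1 hrange⟩) ht
    · exact ContinuousLinearMap.coe_injective (LinearMap.ker_eq_top.1 hker)
  exact (sub_eq_zero.1 (hd ▸ hzero)).symm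

/-- Finite-dimensional subspaces are closed, so invariance passes from the generators to the whole
completed algebra. -/
theorem eq_bot_or_eq_top_of_finiteDimensional (hT : IsIrreducible T) (W : Submodule ℂ V)
    [FiniteDimensional ℂ W] (hW : ∀ x, ∀ w ∈ W, T (gen ħ x) w ∈ W) : W = ⊥ ∨ W = ⊤ := by
  let S : Subalgebra ℂ (V →L[ℂ] V) :=
    { carrier := {z | ∀ w ∈ W, z w ∈ W}
      mul_mem' := fun ha hb w hw ↦ ha _ (hb w hw)
      add_mem' := fun ha hb w hw ↦ W.add_mem (ha w hw) (hb w hw)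
      algebraMap_mem' := fun t w hw ↦ by
        simpa [Algebra.algebraMap_eq_smul_one] using W.smul_mem t hw }
  have hS : IsClosed (S : Set (V →L[ℂ] V)) := by
    have : (S : Set (V →L[ℂ] V)) = ⋂ w ∈ W, {z | z w ∈ W} := by
      ext
      simp only [Set.mem_iInter]
      rfl
    rw [this]
    exact isClosed_biInter fun w _ ↦ W.closed_of_finiteDimensional.preimage (by fun_prop)
  exact hT.eq_bot_or_eq_top W fun a ↦ map_mem_of_isClosed T S hS hW a

/-- Needed twice: `m = s` shows `F^s v = 0`, and `m = 0` shows that the `F^n v` span `V`. -/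
theorem span_pow_eq_bot_or_eq_top (hT : IsIrreducible T) {ν : ℂ} {v : V}
    (hħ : Complex.sinh ħ ≠ 0) (hv : T (gen ħ .H) v = ν • v) (hev : T (gen ħ .E) v = 0) {m : ℕ}
    (hm : T (gen ħ .E) ((T (gen ħ .F) ^ m) v) = 0) :
    let W := Submodule.span ℂ (Set.range fun n ↦ (T (gen ħ .F) ^ (m + n)) v)
    W = ⊥ ∨ W = ⊤ := by
  intro W
  have hr := (relations ħ).map T
  set f := T (gen ħ .F)
  obtain ⟨N, hN⟩ := isNilpotent_of_commutator (by norm_num) hr.hf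
  have hmem (n : ℕ) : (f ^ (m + n)) v ∈ W := Submodule.subset_span ⟨n, rfl⟩
  have hfin : (Set.range fun n ↦ (f ^ (m + n)) v).Finite := by
    refine ((Set.finite_range fun n : Fin N ↦ (f ^ (m + n)) v).insert 0).subset ?_
    rintro _ ⟨n, rfl⟩
    rcases lt_or_ge n N with hn | hn
    · exact Or.inr ⟨⟨n, hn⟩, rfl⟩
    · exact Or.inl (by simp [pow_eq_zero_of_le (show N ≤ m + n by omega) hN])
  have : FiniteDimensional ℂ W := FiniteDimensional.span_of_finite ℂ hfin
  refine hT.eq_bot_or_eq_top_of_finiteDimensional W fun x w hw ↦ ?_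
  suffices h : W ≤ W.comap (T (gen ħ x)).toLinearMap from h hw
  refine Submodule.span_le.2 ?_
  rintro _ ⟨n, rfl⟩
  change T (gen ħ x) ((f ^ (m + n)) v) ∈ W
  cases x with
  | E =>
    cases n with
    | zero => rw [add_zero, hm]; exact W.zero_mem
    | succ n =>
      rw [← add_assoc, hr.apply_pow_succ hħ hv hev]
      exact W.smul_mem _ (hmem n)
  | F =>
    have := hmem (n + 1)
    rwa [← add_assoc, pow_succ_apply] at this
  | H =>
    rw [apply_pow_of_commutator hr.hf hv]
    exact W.smul_mem _ (hmem n)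

theorem finrank_le_of_sinh_eq_zero [CompleteSpace V] (hT : IsIrreducible T)
    (hħ : Complex.sinh ħ ≠ 0) {s : ℕ} (hs : s ≠ 0) (hexp : Complex.exp (s * ħ * 2) = 1) :
    FiniteDimensional ℂ V ∧ Module.finrank ℂ V ≤ s := by
  have := hT.nontrivial
  have hr := (relations ħ).map T
  have hħ0 : ħ ≠ 0 := by
    rintro rfl
    simp at hħ
  have hsinh : Complex.sinh (s * ħ) = 0 := by
    rw [Complex.sinh, Complex.exp_neg]
    have h1 : Complex.exp (s * ħ) * Complex.exp (s * ħ) = 1 := by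
      rw [← Complex.exp_add, ← mul_two, hexp]
    rw [← eq_inv_of_mul_eq_one_left h1]
    simp
  obtain ⟨t, ht⟩ := hT.eq_algebraMap_of_commute
    (c := NormedSpace.exp ((s * ħ : ℂ) • T (gen ħ .H))) (by
      rintro (_ | _ | _)
      · exact commute_exp_of_commutator hr.he hexp
      · exact commute_exp_of_commutator hr.hf (by rw [mul_neg, Complex.exp_neg, hexp, inv_one])
      · exact ((Commute.refl _).smul_left _).exp_left)
  obtain ⟨μ, w, hw, hμ⟩ := exists_eigenvector_of_exp_eq_algebraMap
    (mul_ne_zero (Nat.cast_ne_zero.2 hs) hħ0) ht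
  obtain ⟨ν, v, hv, hν, hev⟩ := exists_highest_weight_vector hr.he hw hμ
  set f := T (gen ħ .F)
  obtain ⟨k, rfl⟩ := Nat.exists_eq_succ_of_ne_zero hs
  have hfs : (f ^ (k + 1)) v = 0 := by
    have hm : T (gen ħ .E) ((f ^ (k + 1)) v) = 0 := by
      rw [hr.apply_pow_succ hħ hν hev, hsinh, zero_mul, zero_div, zero_smul]
    rcases hT.span_pow_eq_bot_or_eq_top hħ hν hev hm with h | h
    · exact Submodule.span_eq_bot.1 h _ ⟨0, rfl⟩
    · have hsurj : Function.Surjective f := by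
        refine LinearMap.range_eq_top.1 (top_le_iff.1 (h ▸ Submodule.span_le.2 ?_))
        rintro _ ⟨n, rfl⟩
        refine ⟨(f ^ (k + n)) v, ?_⟩
        exact (pow_succ_apply f _ v).symm.trans (by rw [add_right_comm])
      obtain ⟨N, hN⟩ := isNilpotent_of_commutator (by norm_num) hr.hf
      obtain ⟨u, hu⟩ := hsurj.iterate N v
      have h0 : (f ^ N) u = v := by simpa using hu
      rw [hN] at h0
      exact absurd h0.symm hv
  have htop : Submodule.span ℂ (Set.range fun i : Fin (k + 1) ↦ (f ^ (i : ℕ)) v) = ⊤ := by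
    rcases hT.span_pow_eq_bot_or_eq_top (m := 0) hħ hν hev (by simpa using hev) with h | h
    · exact absurd (Submodule.span_eq_bot.1 h _ ⟨0, rfl⟩) (by simpa using hv)
    · refine top_le_iff.1 (h ▸ Submodule.span_le.2 ?_)
      rintro _ ⟨n, rfl⟩
      rcases lt_or_ge n (k + 1) with hn | hn
      · exact Submodule.subset_span ⟨⟨n, hn⟩, by simp only [zero_add, f]⟩
      · obtain ⟨j, rfl⟩ := Nat.exists_eq_add_of_le' hn
        rw [SetLike.mem_coe]
        simp only [zero_add, pow_add _ j]
        have h0 : (f ^ j * f ^ (k + 1)) v = 0 := (congrArg (f ^ j) hfs).trans (map_zero _)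
        exact h0 ▸ Submodule.zero_mem _
  refine ⟨Module.finite_def.2 (htop ▸ Submodule.fg_span (Set.finite_range _)), ?_⟩
  rw [← finrank_top, ← htop]
  exact (finrank_range_le_card _).trans_eq (Fintype.card_fin _)

end IsIrreducible

end Banach

end QuantumSl2

theorem theorem2p6 (ħ : ℂ) (hsinh : Complex.sinh ħ ≠ 0) (hroot : IsOfFinOrder (Complex.exp ħ))
    {V : Type*} [NormedAddCommGroup V] [NormedSpace ℂ V] [CompleteSpace V]
    (T : QuantumSl2 ħ →A[ℂ] (V →L[ℂ] V)) (hT : QuantumSl2.IsIrreducible T) :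
    FiniteDimensional ℂ V ∧
      Module.finrank ℂ V ≤
        if Odd (orderOf (Complex.exp ħ)) then orderOf (Complex.exp ħ)
        else orderOf (Complex.exp ħ) / 2 := by
  have hpos := hroot.orderOf_pos
  have hpow := pow_orderOf_eq_one (Complex.exp ħ)
  have hexp (s : ℕ) : Complex.exp (s * ħ * 2) = Complex.exp ħ ^ (s * 2) := by
    rw [← Complex.exp_nat_mul]
    congr 1
    push_cast
    ring
  -- Only `d ∣ 2s` is needed: `2s = 2d` for odd `d`, and `2s = d` for even `d`.
  split_ifs with hd
  · exact hT.finrank_le_of_sinh_eq_zero hsinh hpos.ne' (by rw [hexp, pow_mul, hpow, one_pow])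
  · have h2 := Nat.div_mul_cancel (Nat.not_odd_iff_even.1 hd).two_dvd
    exact hT.finrank_le_of_sinh_eq_zero hsinh (by omega) (by rw [hexp, h2, hpow])
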